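/- Let $q$ be a complex number with $0<|q|<1$, fix any eighth root $q^{1/8}$ of $q$, and put $q^{3/8}=(q^{1/8})^3$ and $q^{1/4}=(q^{1/8})^2$. Write $(x;q)_n=\prod_{k=0}^{n-1}(1-xq^k)$, and let $$\sigma(q)=\sum_{n=0}^{\infty}\frac{q^{n(n+1)/2}}{(-q;q)_n}$$ be the Andrews–Dyson–Hickerson function. For integers $a,b,c$ let $$\overline{f}_{a,b,c}(x,y,q)=\sum_{\substack{(r,s)\in\mathbb{Z}^2\\ \operatorname{sg}(r)=\operatorname{sg}(s)}}(-1)^{r+s}x^r y^s q^{a\binom{r}{2}+brs+c\binom{s}{2}},$$ where $\operatorname{sg}(r)=1$ for $r\ge 0$, $\operatorname{sg}(r)=-1$ for $r<0$, and $\binom{r}{2}=r(r-1)/2$. Then the series defining $\sigma(q)$ and $\overline{f}_{1,5,1}(q^{3/8},-q^{3/8},q^{1/4})$ converge absolutely, and $$\sigma(q)=\overline{f}_{1,5,1}(q^{3/8},-q^{3/8},q^{1/4}).$$ -/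

import Mathlib

/-- The finite `q`-shifted factorial `(x; q)_n = ∏_{k=0}^{n-1} (1 - x q^k)`. -/
def qPoch (x q : ℂ) (n : ℕ) : ℂ := ∏ k ∈ Finset.range n, (1 - x * q ^ k)

/-- The `n`-th summand `q^{n(n+1)/2} / (-q; q)_n` of the Andrews-Dyson-Hickerson function. -/
noncomputable def sigmaTerm (q : ℂ) (n : ℕ) : ℂ := q ^ (n * (n + 1) / 2) / qPoch (-q) q n

/-- The Andrews-Dyson-Hickerson function `σ(q) = ∑_{n ≥ 0} q^{n(n+1)/2} / (-q; q)_n`. -/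
noncomputable def sigmaADH (q : ℂ) : ℂ := ∑' n : ℕ, sigmaTerm q n

/-- The sign convention `sg(r) = 1` for `r ≥ 0` and `sg(r) = -1` for `r < 0`. -/
def sg (r : ℤ) : ℤ := if 0 ≤ r then 1 else -1

/-- The summand `(-1)^{r+s} x^r y^s q^{a binom(r,2) + b r s + c binom(s,2)}`, where
`binom(r,2) = r(r-1)/2` for every integer `r` (the division is exact). -/
noncomputable def barfTerm (a b c : ℤ) (x y q : ℂ) (r s : ℤ) : ℂ :=
  (-1) ^ (r + s) * x ^ r * y ^ s *
    q ^ (a * (r * (r - 1) / 2) + b * r * s + c * (s * (s - 1) / 2))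

/-- The building block `\bar f_{a,b,c}(x,y,q)`: the sum of `barfTerm a b c x y q r s` over all
pairs of integers `(r, s)` with `sg(r) = sg(s)`. -/
noncomputable def barf (a b c : ℤ) (x y q : ℂ) : ℂ :=
  ∑' p : {p : ℤ × ℤ // sg p.1 = sg p.2}, barfTerm a b c x y q p.1.1 p.1.2

/-!
The proof passes from both sides to the single series `∑ r, (1 - q^(2r+1)) D(2r) q^(r(r+1)/2)`,
where `D(N) = ∑_{a+b=N} (-1)^a q^(ab)` is `altSum q N`.

On the side of `σ(q)` this is an instance of Bailey's lemma. The polynomials `D(2r)` satisfy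
`D(2r+2) = 2 - q^(2r+1) D(2r)`, which makes a summation by parts against the weights
`1 / ((q;q)_{n-r} (q;q)_{n+r+1})` possible (`sum_range_bailey`); comparing `n` with `n + 1` yields the
Bailey pair `bailey_pair`, that is, `(-1)^n / (q²;q²)_n` as a finite sum over `r ≤ n`.
Substituting it writes `sigmaTerm q n` as a sum over `r + m = n` of an absolutely summable double
series. For fixed `r`, the sum over `m` is the `₁φ₁` series `∑ m, kernelTerm q r m`, whose value
is `1` for every `r` (`hasSum_kernelTerm`): it telescopes for `r = 0`, and so does the difference
of the series for `r` and `r + 1`.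

On the side of `barf`, with `t^8 = q`, the summand at `(r, s)` is
`(-1)^r t^(r² + s² + 10rs + 2r + 2s)`. The reflection `(r, s) ↦ (-1-r, -1-s)` identifies the two halves of the index set and
multiplies the summand by `-q^(r+s+1)`. Since `r² + s² + 10rs = (r+s)² + 8rs`, summing over the
diagonals `r + s = N` produces `(1 - q^(N+1)) t^(N²+2N) D(N)`. The terms with `N` odd vanish, and
those with `N = 2r` are the terms of the single series (`tsum_coneTerm`).
-/

open Finset Filter Topology

/-! ### The factorials `(q;q)_n` and `(-q;q)_n` -/

theorem qPoch_succ (x q : ℂ) (n : ℕ) : qPoch x q (n + 1) = qPoch x q n * (1 - x * q ^ n) := by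
  simp [qPoch, Finset.prod_range_succ]

theorem one_sub_pow_succ_ne_zero {q : ℂ} (hq : ‖q‖ < 1) (n : ℕ) : 1 - q ^ (n + 1) ≠ 0 := by
  intro h
  have h1 : ‖q‖ ^ (n + 1) = 1 := by rw [← norm_pow, ← sub_eq_zero.mp h, norm_one]
  exact (pow_lt_one₀ (norm_nonneg q) hq n.succ_ne_zero).ne h1

theorem one_add_pow_succ_ne_zero {q : ℂ} (hq : ‖q‖ < 1) (n : ℕ) : 1 + q ^ (n + 1) ≠ 0 := by
  intro h
  have h1 : ‖q‖ ^ (n + 1) = 1 := by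
    rw [← norm_pow, eq_neg_of_add_eq_zero_right h, norm_neg, norm_one]
  exact (pow_lt_one₀ (norm_nonneg q) hq n.succ_ne_zero).ne h1

theorem qPoch_self_succ (q : ℂ) (n : ℕ) :
    qPoch q q (n + 1) = qPoch q q n * (1 - q ^ (n + 1)) := by
  rw [qPoch_succ, pow_succ']

theorem qPoch_self_ne_zero {q : ℂ} (hq : ‖q‖ < 1) (n : ℕ) : qPoch q q n ≠ 0 := by
  refine Finset.prod_ne_zero_iff.mpr fun k _ => ?_
  rw [← pow_succ']
  exact one_sub_pow_succ_ne_zero hq k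

theorem qPoch_neg_succ (q : ℂ) (n : ℕ) :
    qPoch (-q) q (n + 1) = qPoch (-q) q n * (1 + q ^ (n + 1)) := by
  rw [qPoch_succ, pow_succ']; ring

theorem qPoch_neg_ne_zero {q : ℂ} (hq : ‖q‖ < 1) (n : ℕ) : qPoch (-q) q n ≠ 0 := by
  refine Finset.prod_ne_zero_iff.mpr fun k _ => ?_
  rw [neg_mul, ← pow_succ', sub_neg_eq_add]
  exact one_add_pow_succ_ne_zero hq k

theorem norm_qPoch_self_le {q : ℂ} (hq : ‖q‖ < 1) (n : ℕ) : ‖qPoch q q n‖ ≤ 2 ^ n := by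
  induction n with
  | zero => simp [qPoch]
  | succ n ih =>
    rw [qPoch_self_succ, norm_mul, pow_succ (2 : ℝ)]
    gcongr
    calc ‖1 - q ^ (n + 1)‖ ≤ ‖(1 : ℂ)‖ + ‖q ^ (n + 1)‖ := norm_sub_le _ _
      _ ≤ 2 := by
        rw [norm_one, norm_pow]
        linarith [pow_le_one₀ (n := n + 1) (norm_nonneg q) hq.le]

theorem norm_inv_qPoch_self_le {q : ℂ} (hq : ‖q‖ < 1) (n : ℕ) :
    ‖(qPoch q q n)⁻¹‖ ≤ ((1 - ‖q‖)⁻¹) ^ n := by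
  have h0 : 0 < 1 - ‖q‖ := by linarith
  induction n with
  | zero => simp [qPoch]
  | succ n ih =>
    rw [qPoch_self_succ, mul_inv, norm_mul, pow_succ (1 - ‖q‖)⁻¹]
    gcongr
    rw [norm_inv]
    refine inv_anti₀ h0 ?_
    calc 1 - ‖q‖ ≤ ‖(1 : ℂ)‖ - ‖q ^ (n + 1)‖ := by
          rw [norm_one, norm_pow]
          exact sub_le_sub_left (pow_le_of_le_one (norm_nonneg q) hq.le n.succ_ne_zero) 1
      _ ≤ _ := norm_sub_norm_le _ _

/-! ### Triangular numbers and the alternating sums -/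

/-- The `n`-th triangular number, in the form in which it occurs in `sigmaTerm`. -/
def tri (n : ℕ) : ℕ := n * (n + 1) / 2

theorem two_mul_tri (n : ℕ) : 2 * tri n = n * (n + 1) :=
  Nat.mul_div_cancel' (Nat.even_mul_succ_self n).two_dvd

theorem tri_succ (n : ℕ) : tri (n + 1) = tri n + (n + 1) := by
  have h1 := two_mul_tri n
  have h2 := two_mul_tri (n + 1)
  nlinarith

theorem tri_add (m r : ℕ) : tri (m + r) = tri m + tri r + m * r := by
  have h1 := two_mul_tri m
  have h2 := two_mul_tri r
  have h3 := two_mul_tri (m + r)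
  nlinarith

/-- The alternating sum `∑_{a + b = N} (-1)^a q^{ab}`. -/
def altSum (q : ℂ) (N : ℕ) : ℂ := ∑ p ∈ antidiagonal N, (-1) ^ p.1 * q ^ (p.1 * p.2)

theorem altSum_add_two (q : ℂ) (N : ℕ) :
    altSum q (N + 2) = 1 + (-1) ^ N - q ^ (N + 1) * altSum q N := by
  have h : ∀ p ∈ antidiagonal N, (-1 : ℂ) ^ (p.1 + 1) * q ^ ((p.1 + 1) * (p.2 + 1)) =
      -(q ^ (N + 1)) * ((-1) ^ p.1 * q ^ (p.1 * p.2)) := by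
    intro p hp
    rw [← mem_antidiagonal.mp hp]
    ring
  simp only [altSum, Finset.Nat.antidiagonal_succ_succ', Finset.sum_cons, Finset.sum_map,
    Function.Embedding.prodMap, Function.Embedding.coeFn_mk, Prod.map, Nat.succ_eq_add_one]
  rw [Finset.sum_congr rfl h, ← Finset.mul_sum]
  simp
  ring

theorem altSum_zero (q : ℂ) : altSum q 0 = 1 := by simp [altSum]

theorem altSum_odd (q : ℂ) (n : ℕ) : altSum q (2 * n + 1) = 0 := by
  induction n with
  | zero => simp [altSum, Finset.Nat.antidiagonal_succ]
  | succ n ih =>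
    rw [show 2 * (n + 1) + 1 = (2 * n + 1) + 2 by ring, altSum_add_two, ih]
    simp [pow_succ]

theorem altSum_even_succ (q : ℂ) (n : ℕ) :
    altSum q (2 * (n + 1)) = 2 - q ^ (2 * n + 1) * altSum q (2 * n) := by
  rw [show 2 * (n + 1) = 2 * n + 2 by ring, altSum_add_two]
  norm_num

theorem norm_altSum_le {q : ℂ} (hq : ‖q‖ < 1) (N : ℕ) : ‖altSum q N‖ ≤ N + 1 := by
  calc ‖altSum q N‖ ≤ ∑ p ∈ antidiagonal N, (1 : ℝ) := by
        refine norm_sum_le_of_le _ fun p _ => ?_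
        simpa using pow_le_one₀ (norm_nonneg q) hq.le
    _ = N + 1 := by simp

/-! ### The Bailey pair -/

/-- Summation by parts, with `n = R + k`. Write `(q)_n` for `(q;q)_n`, `D(N)` for `altSum q N`,
and `f(n, r)` for `(1 - q^(2r+1)) / ((q)_{n-r} (q)_{n+r+1})`. The summand is `(-1)^r D(2r)` times
`(1 - q^(2n)) f(n, r) + f(n-1, r)`, because `(q)_{n-r} = (1 - q^(n-r)) (q)_{n-1-r}`. This factor
equals `γ(r) - q^(2r+1) γ(r+1)` with `γ(r) = (2 - q^(n-r) - q^(n+r)) / ((q)_{n-r} (q)_{n+r})`, so that the recurrence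
`D(2r+2) = 2 - q^(2r+1) D(2r)` leaves a boundary term and the alternating sum of `γ`, which
telescopes. -/
theorem sum_range_bailey {q : ℂ} (hq : ‖q‖ < 1) (R k : ℕ) :
    ∑ r ∈ range R, (-1) ^ r * ((1 - q ^ (2 * r + 1)) * altSum q (2 * r)) *
      ((1 - q ^ (2 * (R + k))) / (qPoch q q (R + k - r) * qPoch q q (R + k + r + 1)) +
        (1 - q ^ (R + k - r)) / (qPoch q q (R + k - r) * qPoch q q (R + k + r))) =
    (-1) ^ R * (2 * (1 - q ^ k) - (2 - q ^ k - q ^ (2 * R + k)) * altSum q (2 * R)) /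
      (qPoch q q k * qPoch q q (2 * R + k)) := by
  induction R generalizing k with
  | zero =>
    rw [Nat.mul_zero, altSum_zero, Nat.zero_add,
      show 2 * (1 - q ^ k) - (2 - q ^ k - q ^ k) * 1 = 0 by ring]
    simp
  | succ R ih =>
    rw [Finset.sum_range_succ]
    have h := ih (k + 1)
    rw [show R + (k + 1) = R + 1 + k by ring] at h
    rw [h, show R + 1 + k - R = k + 1 by omega, altSum_even_succ,
      show R + 1 + k + R + 1 = 2 * R + k + 2 by ring, show R + 1 + k + R = 2 * R + k + 1 by ring,
      show 2 * (R + 1) + k = 2 * R + k + 2 by ring, show 2 * R + (k + 1) = 2 * R + k + 1 by ring,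
      qPoch_self_succ q (2 * R + k + 1), qPoch_self_succ q k]
    have h1 := qPoch_self_ne_zero hq k
    have h2 := qPoch_self_ne_zero hq (2 * R + k + 1)
    have h3 := one_sub_pow_succ_ne_zero hq k
    have h4 := one_sub_pow_succ_ne_zero hq (2 * R + k + 1)
    field_simp
    ring

/-- The Bailey pair relative to `a = q` behind the identity: both sides satisfy the recurrence
`(1 - q^(2n+2)) A(n+1) + A(n) = 0`. Note that `(q;q)_n (-q;q)_n = (q²;q²)_n`. -/
theorem bailey_pair {q : ℂ} (hq : ‖q‖ < 1) (n : ℕ) :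
    ∑ r ∈ range (n + 1), (-1) ^ r * ((1 - q ^ (2 * r + 1)) * altSum q (2 * r)) /
      (qPoch q q (n - r) * qPoch q q (n + r + 1)) =
    (-1) ^ n / (qPoch q q n * qPoch (-q) q n) := by
  induction n with
  | zero =>
    have := one_sub_pow_succ_ne_zero hq 0
    simp [altSum_zero, qPoch] at this ⊢
    exact this
  | succ n ih =>
    -- Together with the term `r = n + 1`, which is split off below, this is the recurrence in `n`.
    have h := sum_range_bailey hq (n + 1) 0
    simp only [mul_add, Finset.sum_add_distrib, add_zero] at h
    have h1 : ∀ r ∈ range (n + 1), (-1) ^ r * ((1 - q ^ (2 * r + 1)) * altSum q (2 * r)) *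
        ((1 - q ^ (n + 1 - r)) / (qPoch q q (n + 1 - r) * qPoch q q (n + 1 + r))) =
        (-1) ^ r * ((1 - q ^ (2 * r + 1)) * altSum q (2 * r)) /
      (qPoch q q (n - r) * qPoch q q (n + r + 1)) := by
      intro r hr
      have hr : r ≤ n := by simpa [Nat.lt_succ_iff] using hr
      obtain ⟨k, rfl⟩ := Nat.exists_eq_add_of_le hr
      rw [show r + k + 1 - r = k + 1 by omega, show r + k - r = k by omega, qPoch_self_succ q k,
        show r + k + 1 + r = r + k + r + 1 by ring]
      have h3 := one_sub_pow_succ_ne_zero hq k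
      have h1 := qPoch_self_ne_zero hq k
      have h2 := qPoch_self_ne_zero hq (r + k + r + 1)
      field_simp
    have h2 : ∀ r ∈ range (n + 1), (-1) ^ r * ((1 - q ^ (2 * r + 1)) * altSum q (2 * r)) *
        ((1 - q ^ (2 * n + 2)) / (qPoch q q (n + 1 - r) * qPoch q q (n + 1 + r + 1))) =
        (1 - q ^ (2 * n + 2)) * ((-1) ^ r * ((1 - q ^ (2 * r + 1)) * altSum q (2 * r)) /
      (qPoch q q (n + 1 - r) * qPoch q q (n + 1 + r + 1))) := by
      intro r hr
      ring
    rw [show 2 * n + 2 * 1 = 2 * n + 2 by ring] at h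
    rw [Finset.sum_congr rfl h1, Finset.sum_congr rfl h2, ih, ← Finset.mul_sum] at h
    rw [Finset.sum_range_succ]
    have e1 := one_sub_pow_succ_ne_zero hq n
    have e2 := one_add_pow_succ_ne_zero hq n
    have e3 := one_sub_pow_succ_ne_zero hq (2 * n + 1)
    have e4 := one_sub_pow_succ_ne_zero hq (2 * n + 2)
    have e5 := qPoch_self_ne_zero hq n
    have e6 := qPoch_neg_ne_zero hq n
    have e7 := qPoch_self_ne_zero hq (2 * n + 2)
    have e8 : (1 : ℂ) - q ^ (2 * n + 2) = (1 - q ^ (n + 1)) * (1 + q ^ (n + 1)) := by ring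
    rw [← mul_right_inj' e3, mul_add, eq_sub_of_add_eq h, qPoch_self_succ q n, qPoch_neg_succ q n,
      Nat.sub_self, show n + 1 + (n + 1) + 1 = 2 * n + 2 + 1 by ring,
      qPoch_self_succ q (2 * n + 2), show 2 * (n + 1) = 2 * n + 2 by ring, e8]
    simp only [qPoch, Finset.range_zero, Finset.prod_empty] at *
    field_simp
    ring

/-! ### The inner sum of Bailey's lemma -/

/-- Quadratic exponents beat geometric growth. -/
theorem exists_pow_mul_pow_tri_le {x : ℝ} (hx0 : 0 ≤ x) (hx1 : x < 1) (K : ℝ) :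
    ∃ C, ∀ n, K ^ n * x ^ tri n ≤ C := by
  have h : Tendsto (fun n : ℕ => K * x ^ (n + 1)) atTop (𝓝 0) := by
    simpa using ((tendsto_pow_atTop_nhds_zero_of_lt_one hx0 hx1).comp
      (tendsto_add_atTop_nat 1)).const_mul K
  have h1 : ∀ᶠ n : ℕ in atTop, ‖K ^ (n + 1) * x ^ tri (n + 1)‖ ≤ 1 / 2 * ‖K ^ n * x ^ tri n‖ := by
    filter_upwards [(h.norm).eventually_le_const (show ‖(0 : ℝ)‖ < 1 / 2 by norm_num)] with n hn
    rw [tri_succ, show K ^ (n + 1) * x ^ (tri n + (n + 1)) =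
      (K * x ^ (n + 1)) * (K ^ n * x ^ tri n) by ring, norm_mul (K * x ^ (n + 1))]
    gcongr
  have h2 := summable_of_ratio_norm_eventually_le (f := fun n => K ^ n * x ^ tri n)
    (show (1 / 2 : ℝ) < 1 by norm_num) h1
  obtain ⟨C, hC⟩ := h2.tendsto_atTop_zero.bddAbove_range
  exact ⟨C, fun n => hC ⟨n, rfl⟩⟩

/-- The `m`-th term of the series `∑_m (-1)^m q^(m(m+1)/2 + mr) (q)_{m+r} / ((q)_m (q)_{m+2r+1})`,
which up to normalization is a `₁φ₁`. Up to the factor `(-1)^r q^(r(r+1)/2)`, its sum is the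
coefficient of the `r`-th member of the Bailey pair when the pair is inserted into `σ(q)`; the
index is `m = n - r`. -/
noncomputable def kernelTerm (q : ℂ) (r m : ℕ) : ℂ :=
  (-1) ^ m * q ^ (tri m + m * r) * qPoch q q (m + r) / (qPoch q q m * qPoch q q (m + 2 * r + 1))

/-- The ratio `1/6` leaves room for the factor `(1 - q^(2r+1)) altSum q (2r)`, whose norm is at
most `2 * 3^r`. -/
theorem exists_norm_kernelTerm_le {q : ℂ} (hq : ‖q‖ < 1) :
    ∃ C, ∀ r m, ‖q ^ tri r * kernelTerm q r m‖ ≤ C * (1 / 6) ^ (r + m) := by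
  set B := (1 - ‖q‖)⁻¹
  have h0 : 0 < 1 - ‖q‖ := by linarith
  have hB0 : 0 < B := inv_pos.mpr h0
  -- `12 = 2 * 6`: each factor of `(q;q)_{m+r}` is at most `2`, and `6` compensates the ratio `1/6`.
  obtain ⟨C, hC⟩ := exists_pow_mul_pow_tri_le (norm_nonneg q) hq (12 * B ^ 2)
  refine ⟨C * B, fun r m => ?_⟩
  have h : q ^ tri r * kernelTerm q r m = (-1) ^ m * q ^ tri (r + m) *
      (qPoch q q (m + r) * ((qPoch q q m)⁻¹ * (qPoch q q (m + 2 * r + 1))⁻¹)) := by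
    rw [kernelTerm, tri_add, div_eq_mul_inv, mul_inv]
    ring
  rw [h]
  simp only [norm_mul, norm_pow, norm_neg, norm_one, one_pow, one_mul]
  calc ‖q‖ ^ tri (r + m) * (‖qPoch q q (m + r)‖ * (‖(qPoch q q m)⁻¹‖ *
        ‖(qPoch q q (m + 2 * r + 1))⁻¹‖))
      ≤ ‖q‖ ^ tri (r + m) * (2 ^ (m + r) * (B ^ m * B ^ (m + 2 * r + 1))) := by
        gcongr
        · exact norm_qPoch_self_le hq _
        · exact norm_inv_qPoch_self_le hq _
        · exact norm_inv_qPoch_self_le hq _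
    _ = ((12 * B ^ 2) ^ (r + m) * ‖q‖ ^ tri (r + m)) * B * (1 / 6) ^ (r + m) := by
        rw [show (12 : ℝ) * B ^ 2 = 2 * B ^ 2 * 6 by ring, mul_pow _ (6 : ℝ)]
        have h6 : (6 : ℝ) ^ (r + m) * (1 / 6) ^ (r + m) = 1 := by rw [← mul_pow]; norm_num
        linear_combination -(‖q‖ ^ tri (r + m) * (2 * B ^ 2) ^ (r + m) * B) * h6
    _ ≤ C * B * (1 / 6) ^ (r + m) := by
        gcongr
        exact hC _

theorem summable_kernelTerm {q : ℂ} (hq0 : q ≠ 0) (hq : ‖q‖ < 1) (r : ℕ) :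
    Summable (kernelTerm q r) := by
  obtain ⟨C, hC⟩ := exists_norm_kernelTerm_le hq
  rw [← summable_mul_left_iff (pow_ne_zero (tri r) hq0)]
  refine Summable.of_norm_bounded ?_ (hC r)
  simp only [pow_add]
  exact ((summable_geometric_of_lt_one (by norm_num) (by norm_num)).mul_left _).mul_left _

theorem sum_kernelTerm_zero {q : ℂ} (hq : ‖q‖ < 1) (M : ℕ) :
    ∑ m ∈ range M, kernelTerm q 0 m = 1 - kernelTerm q 0 M * (1 - q ^ (M + 1)) := by
  have h (m : ℕ) : kernelTerm q 0 m = (-1) ^ m * q ^ tri m / qPoch q q (m + 1) := by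
    have := qPoch_self_ne_zero hq m
    simp only [kernelTerm, mul_zero, add_zero]
    field_simp
  induction M with
  | zero =>
    have := one_sub_pow_succ_ne_zero hq 0
    simp [h, tri, qPoch] at this ⊢
    field_simp
    simp
  | succ M ih =>
    rw [Finset.sum_range_succ, ih, h, h, qPoch_self_succ q (M + 1), tri_succ]
    have h1 := qPoch_self_ne_zero hq (M + 1)
    have h2 := one_sub_pow_succ_ne_zero hq (M + 1)
    field_simp
    ring

/-- A Wilf–Zeilberger certificate for the independence of `∑ m, kernelTerm q r m` from `r`. -/
theorem sum_kernelTerm_sub {q : ℂ} (hq : ‖q‖ < 1) (r M : ℕ) :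
    ∑ m ∈ range M, (kernelTerm q r m - kernelTerm q (r + 1) m) =
      -(kernelTerm q r M * ((1 - q ^ M) * (1 - q ^ (M + r + 1) * (1 + q ^ (r + 1))) /
        (1 - q ^ (M + 2 * r + 2)))) := by
  induction M with
  | zero => simp
  | succ M ih =>
    rw [Finset.sum_range_succ, ih]
    simp only [kernelTerm]
    rw [show M + 1 + 2 * r + 1 = M + 2 * r + 1 + 1 by ring,
      show M + 2 * (r + 1) + 1 = M + 2 * r + 1 + 1 + 1 by ring,
      show M + (r + 1) = M + r + 1 by ring,
      show M + 1 + r = M + r + 1 by ring,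
      show M + 1 + 2 * r + 2 = M + 2 * r + 2 + 1 by ring,
      qPoch_self_succ q (M + 2 * r + 1 + 1), qPoch_self_succ q (M + 2 * r + 1),
      qPoch_self_succ q (M + r), qPoch_self_succ q M, tri_succ]
    have h1 := qPoch_self_ne_zero hq M
    have h2 := qPoch_self_ne_zero hq (M + r)
    have h3 := qPoch_self_ne_zero hq (M + 2 * r + 1)
    have h4 := one_sub_pow_succ_ne_zero hq M
    have h5 := one_sub_pow_succ_ne_zero hq (M + 2 * r + 1)
    have h6 := one_sub_pow_succ_ne_zero hq (M + 2 * r + 2)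
    field_simp
    ring

theorem hasSum_kernelTerm {q : ℂ} (hq0 : q ≠ 0) (hq : ‖q‖ < 1) (r : ℕ) :
    HasSum (kernelTerm q r) 1 := by
  have hp (k : ℕ) : Tendsto (fun n : ℕ => q ^ (n + k)) atTop (𝓝 0) :=
    (tendsto_pow_atTop_nhds_zero_of_norm_lt_one hq).comp (tendsto_add_atTop_nat k)
  induction r with
  | zero =>
    have hs := summable_kernelTerm hq0 hq 0
    rw [hs.hasSum_iff_tendsto_nat]
    simp only [sum_kernelTerm_zero hq]
    simpa using (hs.tendsto_atTop_zero.mul ((hp 1).const_sub 1)).const_sub 1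
  | succ r ih =>
    have hs := summable_kernelTerm hq0 hq r
    have h : HasSum (fun m => kernelTerm q r m - kernelTerm q (r + 1) m) 0 := by
      rw [(hs.sub (summable_kernelTerm hq0 hq (r + 1))).hasSum_iff_tendsto_nat]
      simp only [sum_kernelTerm_sub hq]
      have h1 := (((hp 0).const_sub 1).mul
        (((hp (r + 1)).mul_const (1 + q ^ (r + 1))).const_sub 1)).div ((hp (2 * r + 2)).const_sub 1)
        (by simp)
      simpa [add_assoc] using (hs.tendsto_atTop_zero.mul h1).neg
    simpa using ih.sub h

/-! ### The series `σ(q)` as a single series -/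

/-- The double series, indexed by `(r, m)`, obtained from `σ(q)` by inserting the Bailey pair. -/
noncomputable def doubleTerm (q : ℂ) (p : ℕ × ℕ) : ℂ :=
  (1 - q ^ (2 * p.1 + 1)) * altSum q (2 * p.1) *
    (q ^ tri p.1 * kernelTerm q p.1 p.2)

theorem sigmaTerm_eq_sum {q : ℂ} (hq : ‖q‖ < 1) (n : ℕ) :
    sigmaTerm q n = ∑ p ∈ antidiagonal n, doubleTerm q p := by
  have h1 : sigmaTerm q n = (-1) ^ n * q ^ tri n * qPoch q q n *
      ((-1) ^ n / (qPoch q q n * qPoch (-q) q n)) := by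
    have h1 := qPoch_self_ne_zero hq n
    have h2 := qPoch_neg_ne_zero hq n
    rw [sigmaTerm, ← tri]
    field_simp
    simp [← pow_mul]
  rw [h1, ← bailey_pair hq, Finset.Nat.sum_antidiagonal_eq_sum_range_succ_mk, Finset.mul_sum]
  refine Finset.sum_congr rfl fun r hr => ?_
  have hr : r ≤ n := by simpa [Nat.lt_succ_iff] using hr
  obtain ⟨m, rfl⟩ := Nat.exists_eq_add_of_le hr
  simp only [doubleTerm, kernelTerm]
  rw [show r + m - r = m by omega, show r + m + r + 1 = m + 2 * r + 1 by ring, tri_add,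
    add_comm m r]
  have h4 : ((-1 : ℂ) ^ r) * (-1) ^ r = 1 := by rw [← mul_pow]; simp
  linear_combination (q ^ (tri r + tri m + r * m) * qPoch q q (r + m) * (-1) ^ m *
    ((1 - q ^ (2 * r + 1)) * altSum q (2 * r)) / (qPoch q q m * qPoch q q (m + 2 * r + 1))) * h4

theorem summable_doubleTerm {q : ℂ} (hq : ‖q‖ < 1) : Summable (doubleTerm q) := by
  obtain ⟨C, hC⟩ := exists_norm_kernelTerm_le hq
  have hg : Summable fun n : ℕ => (1 / 2 : ℝ) ^ n := summable_geometric_two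
  refine Summable.of_norm_bounded (((hg.mul_of_nonneg hg (fun _ => by positivity)
    (fun _ => by positivity))).mul_left (2 * C)) ?_
  rintro ⟨r, m⟩
  have h1 : ‖1 - q ^ (2 * r + 1)‖ ≤ 2 := by
    refine (norm_sub_le _ _).trans ?_
    rw [norm_one, norm_pow]
    linarith [pow_le_one₀ (n := 2 * r + 1) (norm_nonneg q) hq.le]
  have h2 : ‖altSum q (2 * r)‖ ≤ 3 ^ (r + m) := by
    have h := one_add_mul_le_pow (show (-2 : ℝ) ≤ 2 by norm_num) r
    have h' : (3 : ℝ) ^ r ≤ 3 ^ (r + m) := pow_le_pow_right₀ (by norm_num) (by omega)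
    have h'' := norm_altSum_le hq (2 * r)
    push_cast at h''
    norm_num at h
    linarith
  calc ‖doubleTerm q (r, m)‖
      = ‖1 - q ^ (2 * r + 1)‖ * ‖altSum q (2 * r)‖ * ‖q ^ tri r * kernelTerm q r m‖ := by
        simp only [doubleTerm, norm_mul]
    _ ≤ 2 * 3 ^ (r + m) * (C * (1 / 6) ^ (r + m)) := by
        gcongr
        exact hC r m
    _ = 2 * C * ((1 / 2) ^ r * (1 / 2) ^ m) := by
        rw [← pow_add, show (1 / 2 : ℝ) = 3 * (1 / 6) by norm_num, mul_pow]
        ring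

theorem HasSum.sum_antidiagonal {α : Type*} [AddCommMonoid α] [TopologicalSpace α]
    [ContinuousAdd α] [RegularSpace α] {f : ℕ × ℕ → α} {a : α} (hf : HasSum f a) :
    HasSum (fun n => ∑ p ∈ Finset.HasAntidiagonal.antidiagonal n, f p) a := by
  rw [← Finset.HasAntidiagonal.sigmaAntidiagonalEquivProd.hasSum_iff] at hf
  refine hf.sigma fun n => ?_
  rw [← Finset.sum_coe_sort]
  exact hasSum_fintype _

theorem hasSum_sigmaTerm {q : ℂ} (hq0 : q ≠ 0) (hq : ‖q‖ < 1) :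
    HasSum (sigmaTerm q)
      (∑' r, (1 - q ^ (2 * r + 1)) * altSum q (2 * r) * q ^ tri r) := by
  have hs := (summable_doubleTerm hq).hasSum
  have h1 := hs.prod_fiberwise fun r =>
    (((hasSum_kernelTerm hq0 hq r).mul_left (q ^ tri r)).mul_left
      ((1 - q ^ (2 * r + 1)) * altSum q (2 * r)) : HasSum (fun m => doubleTerm q (r, m)) _)
  simp only [mul_one] at h1
  rw [h1.tsum_eq, funext (sigmaTerm_eq_sum hq)]
  exact hs.sum_antidiagonal

/-! ### The series `barf` as a single series -/

theorem barfTerm_one_five_one {t : ℂ} (ht : t ≠ 0) (r s : ℤ) :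
    barfTerm 1 5 1 (t ^ 3) (-(t ^ 3)) (t ^ 2) r s =
      (-1) ^ r * t ^ (r ^ 2 + s ^ 2 + 10 * r * s + 2 * r + 2 * s) := by
  have hr := Int.mul_ediv_cancel' (Int.even_mul_pred_self r).two_dvd
  have hs := Int.mul_ediv_cancel' (Int.even_mul_pred_self s).two_dvd
  rw [barfTerm, neg_eq_neg_one_mul (t ^ 3), mul_zpow, zpow_add₀ (by norm_num : (-1 : ℂ) ≠ 0)]
  have h1 : (-1 : ℂ) ^ s * (-1) ^ s = 1 := by rw [← mul_zpow]; simp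
  have h2 : (t ^ 3) ^ r * (t ^ 3) ^ s *
      (t ^ 2) ^ (1 * (r * (r - 1) / 2) + 5 * r * s + 1 * (s * (s - 1) / 2)) =
      t ^ (r ^ 2 + s ^ 2 + 10 * r * s + 2 * r + 2 * s) := by
    simp only [← zpow_natCast, ← zpow_mul, ← zpow_add₀ ht]
    congr 1
    push_cast
    linear_combination hr + hs
  linear_combination (-1 : ℂ) ^ r * h2 + (-1) ^ r * (t ^ 3) ^ r * (t ^ 3) ^ s *
      (t ^ 2) ^ (1 * (r * (r - 1) / 2) + 5 * r * s + 1 * (s * (s - 1) / 2)) * h1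

/-- The summand of `barf` at a pair of nonnegative indices, with natural-number exponents. -/
def coneTerm (t : ℂ) (p : ℕ × ℕ) : ℂ :=
  (-1) ^ p.1 * t ^ (p.1 ^ 2 + p.2 ^ 2 + 10 * p.1 * p.2 + 2 * p.1 + 2 * p.2)

theorem barfTerm_natCast {t : ℂ} (ht : t ≠ 0) (a b : ℕ) :
    barfTerm 1 5 1 (t ^ 3) (-(t ^ 3)) (t ^ 2) a b = coneTerm t (a, b) := by
  rw [barfTerm_one_five_one ht, coneTerm, zpow_natCast, ← zpow_natCast t]
  push_cast
  rfl

/-- The reflection `(a, b) ↦ (-1 - a, -1 - b)` multiplies the summand by `-q^(a+b+1)`. -/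
theorem barfTerm_negSucc {t : ℂ} (ht : t ≠ 0) (a b : ℕ) :
    barfTerm 1 5 1 (t ^ 3) (-(t ^ 3)) (t ^ 2) (Int.negSucc a) (Int.negSucc b) =
      -(t ^ (8 * (a + b + 1)) * coneTerm t (a, b)) := by
  rw [barfTerm_one_five_one ht, coneTerm, Int.negSucc_eq, zpow_neg, ← inv_zpow, Int.negSucc_eq,
    show ((-1 : ℂ))⁻¹ = -1 by norm_num, zpow_add_one₀ (by norm_num), zpow_natCast,
    mul_left_comm (t ^ _), ← pow_add, ← zpow_natCast t]
  push_cast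
  ring_nf

/-- Two integers have the same sign when both are of the form `a` or both of the form `-1 - a`,
with `a` natural. -/
def signConeEquiv : (ℕ × ℕ) ⊕ (ℕ × ℕ) ≃ {p : ℤ × ℤ // sg p.1 = sg p.2} where
  toFun := Sum.elim (fun p => ⟨(p.1, p.2), by simp [sg]⟩)
    (fun p => ⟨(Int.negSucc p.1, Int.negSucc p.2), by simp [sg]⟩)
  invFun p := match p with
    | ⟨(Int.ofNat a, Int.ofNat b), _⟩ => Sum.inl (a, b)
    | ⟨(Int.negSucc a, Int.negSucc b), _⟩ => Sum.inr (a, b)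
    | ⟨(Int.ofNat a, Int.negSucc b), h⟩ => absurd h (by simp [sg])
    | ⟨(Int.negSucc a, Int.ofNat b), h⟩ => absurd h (by simp [sg])
  left_inv := by rintro (⟨a, b⟩ | ⟨a, b⟩) <;> rfl
  right_inv := by
    rintro ⟨⟨a | a, b | b⟩, h⟩
    · rfl
    · exact absurd h (by simp [sg])
    · exact absurd h (by simp [sg])
    · rfl

theorem norm_coneTerm_le {t : ℂ} (ht : ‖t‖ < 1) (p : ℕ × ℕ) :
    ‖coneTerm t p‖ ≤ ‖t‖ ^ p.1 * ‖t‖ ^ p.2 := by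
  simp only [coneTerm, norm_mul, norm_pow, norm_neg, norm_one, one_pow, one_mul, ← pow_add]
  exact pow_le_pow_of_le_one (norm_nonneg t) ht.le (by nlinarith)

theorem summable_coneTerm {t : ℂ} (ht : ‖t‖ < 1) : Summable (coneTerm t) := by
  have hg := summable_geometric_of_lt_one (norm_nonneg t) ht
  exact Summable.of_norm_bounded (hg.mul_of_nonneg hg (fun _ => by positivity)
    (fun _ => by positivity)) (norm_coneTerm_le ht)

theorem summable_pow_mul_coneTerm {t : ℂ} (ht : ‖t‖ < 1) :
    Summable fun p : ℕ × ℕ => t ^ (8 * (p.1 + p.2 + 1)) * coneTerm t p := by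
  refine Summable.of_norm_bounded (summable_coneTerm ht).norm fun p => ?_
  rw [norm_mul, norm_pow]
  exact mul_le_of_le_one_left (norm_nonneg _) (pow_le_one₀ (norm_nonneg t) ht.le)

theorem sum_antidiagonal_coneTerm (t : ℂ) (N : ℕ) :
    ∑ p ∈ antidiagonal N, (coneTerm t p - t ^ (8 * (p.1 + p.2 + 1)) * coneTerm t p) =
      (1 - (t ^ 8) ^ (N + 1)) * t ^ (N ^ 2 + 2 * N) * altSum (t ^ 8) N := by
  rw [altSum, Finset.mul_sum]
  refine Finset.sum_congr rfl fun p hp => ?_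
  rw [← mem_antidiagonal.mp hp, coneTerm]
  ring

theorem hasSum_barfTerm {t : ℂ} (ht0 : t ≠ 0) (ht : ‖t‖ < 1) :
    HasSum (fun p : {p : ℤ × ℤ // sg p.1 = sg p.2} =>
      barfTerm 1 5 1 (t ^ 3) (-(t ^ 3)) (t ^ 2) p.1.1 p.1.2)
      (∑' p : ℕ × ℕ, (coneTerm t p - t ^ (8 * (p.1 + p.2 + 1)) * coneTerm t p)) := by
  rw [← signConeEquiv.hasSum_iff, (summable_coneTerm ht).tsum_sub (summable_pow_mul_coneTerm ht),
    sub_eq_add_neg]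
  have hl (p : ℕ × ℕ) : barfTerm 1 5 1 (t ^ 3) (-(t ^ 3)) (t ^ 2)
      (signConeEquiv (Sum.inl p)).1.1 (signConeEquiv (Sum.inl p)).1.2 = coneTerm t p :=
    barfTerm_natCast ht0 p.1 p.2
  have hr (p : ℕ × ℕ) : barfTerm 1 5 1 (t ^ 3) (-(t ^ 3)) (t ^ 2)
      (signConeEquiv (Sum.inr p)).1.1 (signConeEquiv (Sum.inr p)).1.2 =
        -(t ^ (8 * (p.1 + p.2 + 1)) * coneTerm t p) :=
    barfTerm_negSucc ht0 p.1 p.2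
  refine HasSum.sum ?_ ?_
  · simpa only [Function.comp_def, hl] using (summable_coneTerm ht).hasSum
  · simpa only [Function.comp_def, hr] using (summable_pow_mul_coneTerm ht).hasSum.neg

theorem tsum_coneTerm {t : ℂ} (ht : ‖t‖ < 1) :
    ∑' p : ℕ × ℕ, (coneTerm t p - t ^ (8 * (p.1 + p.2 + 1)) * coneTerm t p) =
      ∑' r, (1 - (t ^ 8) ^ (2 * r + 1)) * altSum (t ^ 8) (2 * r) * (t ^ 8) ^ tri r := by
  have h := ((summable_coneTerm ht).sub (summable_pow_mul_coneTerm ht)).hasSum.sum_antidiagonal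
  simp only [sum_antidiagonal_coneTerm] at h
  have hodd : ∀ N ∉ Set.range (fun r : ℕ => 2 * r),
      (1 - (t ^ 8) ^ (N + 1)) * t ^ (N ^ 2 + 2 * N) * altSum (t ^ 8) N = 0 := by
    intro N hN
    obtain ⟨r, rfl⟩ : Odd N := by
      rw [← Nat.not_even_iff_odd, even_iff_exists_two_mul]
      rintro ⟨r, rfl⟩
      exact hN ⟨r, rfl⟩
    rw [altSum_odd, mul_zero]
  have he := (Function.Injective.hasSum_iff (mul_right_injective₀ (two_ne_zero' ℕ)) hodd).mpr h
  rw [← he.tsum_eq]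
  refine tsum_congr fun r => ?_
  have hr : (2 * r) ^ 2 + 2 * (2 * r) = 8 * tri r := by linarith [two_mul_tri r]
  rw [Function.comp_apply, hr, pow_mul t 8 (tri r), mul_right_comm]

/-- For `0 < |q| < 1` and any choice `t` of `q^{1/8}` (so that `q^{3/8} = t^3`, `q^{1/4} = t^2`), both
series converge absolutely and `σ(q) = \bar f_{1,5,1}(q^{3/8}, -q^{3/8}, q^{1/4})`. -/
theorem mainTheorem12 (q : ℂ) (hq0 : q ≠ 0) (hq1 : ‖q‖ < 1) (t : ℂ) (ht : t ^ 8 = q) :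
    Summable (fun n : ℕ => sigmaTerm q n) ∧
    Summable (fun p : {p : ℤ × ℤ // sg p.1 = sg p.2} =>
      barfTerm 1 5 1 (t ^ 3) (-(t ^ 3)) (t ^ 2) p.1.1 p.1.2) ∧
    sigmaADH q = barf 1 5 1 (t ^ 3) (-(t ^ 3)) (t ^ 2) := by
  subst ht
  have ht0 : t ≠ 0 := fun h => hq0 (by simp [h])
  have ht1 : ‖t‖ < 1 := by
    rw [norm_pow] at hq1
    exact lt_of_pow_lt_pow_left₀ 8 zero_le_one (by simpa using hq1)
  have h1 := hasSum_sigmaTerm hq0 hq1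
  have h2 := hasSum_barfTerm ht0 ht1
  refine ⟨h1.summable, h2.summable, ?_⟩
  rw [sigmaADH, barf, h1.tsum_eq, h2.tsum_eq, tsum_coneTerm ht1]
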